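/- For $d\ge 1$ let $|\Phi_d\rangle=\frac1{\sqrt d}\sum_{a=1}^{d}|a\rangle\otimes|a\rangle\in\mathbb C^d\otimes\mathbb C^d$. A state in $\mathbb C^d\otimes\mathbb C^d$ is called maximally entangled if it equals $(I\otimes U)|\Phi_d\rangle$ for some unitary $d\times d$ matrix $U$. A finite family of states $(|\psi_i\rangle)_{i\in I}$ in $\mathbb C^d\otimes\mathbb C^d$ is (perfectly) distinguishable with one-way LOCC if there are a finite family of positive semidefinite $d\times d$ matrices $(A_k)_k$ with $\sum_k A_k=I_d$ and, for each $k$, positive semidefinite $d\times d$ matrices $(B_{k,j})_{j\in I}$ with $\sum_{j\in I} B_{k,j}=I_d$, such that $\langle\psi_i|A_k\otimes B_{k,j}|\psi_i\rangle=0$ for all $k$ and all $i\neq j$ in $I$. Then in arbitrarily high dimensions $d$ (that is, for every $N$ there is a $d\ge N$) there exist four mutually orthogonal maximally entangled states in $\mathbb C^d\otimes\mathbb C^d$ such that any three of them are distinguishable with one-way LOCC, but all four together are not. -/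

import Mathlib

open scoped Kronecker ComplexOrder

noncomputable section

/-- The joint Hilbert space `ℂ^d ⊗ ℂ^d` of Alice (first index) and Bob (second index), in the
product basis `|a⟩ ⊗ |b⟩`. -/
abbrev Bipartite (d : ℕ) : Type := EuclideanSpace ℂ (Fin d × Fin d)

/-- The standard maximally entangled state `d^{-1/2} ∑ₐ |a⟩ ⊗ |a⟩`. -/
def stdMaxEntangled (d : ℕ) : Bipartite d :=
  WithLp.toLp 2 (fun p => if p.1 = p.2 then (((Real.sqrt d)⁻¹ : ℝ) : ℂ) else 0)

/-- `ψ` is maximally entangled: `ψ = (I ⊗ U) Φ` for a unitary `U` on Bob's system, where `Φ` is the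
standard maximally entangled state. -/
def IsMaximallyEntangled {d : ℕ} (ψ : Bipartite d) : Prop :=
  ∃ U ∈ Matrix.unitaryGroup (Fin d) ℂ,
    ψ = Matrix.toEuclideanLin ((1 : Matrix (Fin d) (Fin d) ℂ) ⊗ₖ U) (stdMaxEntangled d)

/-- A one-way LOCC measurement (Alice to Bob) on `ℂ^d ⊗ ℂ^d` whose final answer lies in `ι`:
Alice performs a measurement (POVM) `A` and sends her outcome `k` to Bob, who then performs a
measurement `B k` depending on `k`; his outcome `j : ι` is the answer. The operator belonging
to the outcome `(k, j)` is `A k ⊗ B k j`. -/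
structure OneWayMeasurement (d : ℕ) (ι : Type*) [Fintype ι] where
  /-- The number of outcomes of Alice's measurement. -/
  n : ℕ
  A : Fin n → Matrix (Fin d) (Fin d) ℂ
  B : Fin n → ι → Matrix (Fin d) (Fin d) ℂ
  A_posSemidef : ∀ k, (A k).PosSemidef
  A_sum : ∑ k, A k = 1
  B_posSemidef : ∀ k j, (B k j).PosSemidef
  B_sum : ∀ k, ∑ j, B k j = 1

/-- The operator `A k ⊗ B k j` of the joint outcome `(k, j)`. -/
def OneWayMeasurement.op {d : ℕ} {ι : Type*} [Fintype ι] (M : OneWayMeasurement d ι)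
    (k : Fin M.n) (j : ι) : Matrix (Fin d × Fin d) (Fin d × Fin d) ℂ :=
  M.A k ⊗ₖ M.B k j

/-- The states `ψ i` are perfectly distinguishable with one-way LOCC: some one-way LOCC measurement
never answers `j` when the state `ψ i`, `i ≠ j`, was prepared, i.e.
`⟨ψ i| A k ⊗ B k j |ψ i⟩ = 0` for all `k` and all `i ≠ j`. -/
def OneWayDistinguishable {d : ℕ} {ι : Type*} [Fintype ι] (ψ : ι → Bipartite d) : Prop :=
  ∃ M : OneWayMeasurement d ι, ∀ (k : Fin M.n) (i j : ι), i ≠ j →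
    inner ℂ (ψ i) (Matrix.toEuclideanLin (M.op k j) (ψ i)) = 0

end

/-! The states come from `I` and `σᵢ ⊗ D` on `ℂ² ⊗ ℂ^(m+2)`, with `D = diag(-1, 1, …, 1)`. Their
products `Uᵢᴴ Uⱼ`, `i ≠ j`, are up to phase `σ_k ⊗ D` if `I` is involved and `σ_k ⊗ I` otherwise.
With all four states, both kinds occur for every `k`. An effect `A` of Alice satisfies `A Uᵢᴴ Uⱼ A =
0`, so by linearity `A (σ_k ⊗ |0⟩⟨0|) A = 0` for all three `k`. This forces the `(0,0)` diagonal
entry of `A` to vanish, so the effects cannot sum to `1`. Without the `l`-th state, Alice needs only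
an orthonormal basis in which all `Uᵢᴴ Uⱼ` have zero diagonal. The vectors `(u ⊗ e_a ± v ⊗ e_{a+1})
/ √2`, with `u, v` an eigenbasis of `σ_l`, work by `pauliBasis_diag`: either both diagonal entries
vanish, or they cancel because the signs of `D` are absent. -/

open Matrix

/-- The maximally entangled state `(I ⊗ U) Φ`. -/
noncomputable def entangledState {d : ℕ} (U : Matrix (Fin d) (Fin d) ℂ) : Bipartite d :=
  toEuclideanLin ((1 : Matrix (Fin d) (Fin d) ℂ) ⊗ₖ U) (stdMaxEntangled d)

lemma entangledState_apply {d : ℕ} (U : Matrix (Fin d) (Fin d) ℂ) (p : Fin d × Fin d) :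
    entangledState U p = U p.2 p.1 * (((Real.sqrt d)⁻¹ : ℝ) : ℂ) := by
  obtain ⟨a, b⟩ := p
  simp [entangledState, stdMaxEntangled, mulVec, dotProduct, Fintype.sum_prod_type,
    one_apply]

/-- Matrix elements of product operators between maximally entangled states are traces. -/
lemma inner_entangledState {d : ℕ} (U W A B : Matrix (Fin d) (Fin d) ℂ) :
    inner ℂ (entangledState U) (toEuclideanLin (A ⊗ₖ B) (entangledState W)) =
      (d : ℂ)⁻¹ * trace (Uᴴ * B * W * Aᵀ) := by
  have hs : (((Real.sqrt d)⁻¹ : ℝ) : ℂ) * (((Real.sqrt d)⁻¹ : ℝ) : ℂ) = (d : ℂ)⁻¹ := by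
    rw [← Complex.ofReal_mul, ← mul_inv, Real.mul_self_sqrt (Nat.cast_nonneg d)]
    simp
  simp only [PiLp.inner_apply, RCLike.inner_apply, ofLp_toLpLin, toLin'_apply, mulVec, dotProduct,
    entangledState_apply, Fintype.sum_prod_type, kroneckerMap_apply, trace, diag_apply,
    mul_apply, conjTranspose_apply, transpose_apply, map_mul, Complex.conj_ofReal, ← hs,
    Finset.sum_mul, Finset.mul_sum]
  refine Finset.sum_congr rfl fun a _ => ?_
  rw [Finset.sum_comm]
  refine Finset.sum_congr rfl fun a' _ => ?_
  rw [Finset.sum_comm]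
  refine Finset.sum_congr rfl fun b' _ => Finset.sum_congr rfl fun b _ => ?_
  simp only [starRingEnd_apply]
  ring

lemma inner_entangledState_self {d : ℕ} (U W : Matrix (Fin d) (Fin d) ℂ) :
    inner ℂ (entangledState U) (entangledState W) = (d : ℂ)⁻¹ * trace (Uᴴ * W) := by
  simpa using inner_entangledState U W 1 1

/-! ### One-way distinguishability in terms of `Uᵢᴴ Uⱼ` -/

/-- If `F` is unitary and every column `φ` of `F` satisfies `⟨φ| Uᵢᴴ Uⱼ |φ⟩ = 0` for `i ≠ j`, then
the states `(I ⊗ Uᵢ) Φ` are distinguishable: Alice measures in the conjugate basis. -/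
lemma oneWayDistinguishable_of_unitary {d : ℕ} {ι : Type*} [Fintype ι] [Nonempty ι]
    (U : ι → Matrix (Fin d) (Fin d) ℂ) (hU : ∀ i, (U i)ᴴ * U i = 1)
    (F : Matrix (Fin d) (Fin d) ℂ) (hF : Fᴴ * F = 1)
    (h : ∀ i j, i ≠ j → ∀ k, (Fᴴ * ((U i)ᴴ * U j) * F) k k = 0) :
    OneWayDistinguishable (fun i => entangledState (U i)) := by
  classical
  have hF' : F * Fᴴ = 1 := mul_eq_one_comm.mp hF
  let E : Fin d → Matrix (Fin d) (Fin d) ℂ := fun k => single k k 1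
  have hEE : ∀ k, E k * E k = E k := fun k => by simp [E]
  have hEH : ∀ k, (E k)ᴴ = E k := fun k => by simp [E]
  have hEX : ∀ k (X : Matrix (Fin d) (Fin d) ℂ), E k * X * E k = X k k • E k := fun k X => by
    simp [E, single_mul_mul_single]
  -- The only nonzero column of `T k i` is Bob's state `Uᵢ φ_k` after outcome `k`; these are
  -- orthonormal in `i`.
  let T : Fin d → ι → Matrix (Fin d) (Fin d) ℂ := fun k i => U i * F * E k
  have hTT : ∀ k i j, (T k i)ᴴ * T k j = if i = j then E k else 0 := by
    intro k i j
    have e : (T k i)ᴴ * T k j = E k * (Fᴴ * ((U i)ᴴ * U j) * F) * E k := by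
      simp only [T, conjTranspose_mul, hEH, Matrix.mul_assoc]
    rw [e]
    split_ifs with hij
    · subst hij
      rw [hU, Matrix.mul_one, hF, Matrix.mul_one, hEE]
    · rw [hEX, h i j hij, zero_smul]
  let P : Fin d → ι → Matrix (Fin d) (Fin d) ℂ := fun k i => T k i * (T k i)ᴴ
  have hTE : ∀ k i, T k i * E k = T k i := fun k i => by simp only [T, Matrix.mul_assoc, hEE]
  have hPT : ∀ k i j, P k i * T k j = if i = j then T k j else 0 := by
    intro k i j
    simp only [P, Matrix.mul_assoc, hTT]
    split_ifs with hij
    · rw [hTE, hij]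
    · simp
  let Q : Fin d → Matrix (Fin d) (Fin d) ℂ := fun k => 1 - ∑ i, P k i
  have hQT : ∀ k j, Q k * T k j = 0 := fun k j => by
    simp [Q, Matrix.sub_mul, Finset.sum_mul, hPT]
  have hQH : ∀ k, (Q k)ᴴ = Q k := fun k => by
    simp [Q, P, conjTranspose_sub, conjTranspose_sum]
  have hQQ : ∀ k, Q k * Q k = Q k := fun k => by
    have : Q k * ∑ i, P k i = 0 := by
      simp only [Finset.mul_sum, P, ← Matrix.mul_assoc, hQT]
      simp
    calc Q k * Q k = Q k * 1 - Q k * ∑ i, P k i := by rw [← Matrix.mul_sub]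
      _ = Q k := by rw [this, Matrix.mul_one, sub_zero]
  have hQ : ∀ k, (Q k).PosSemidef := fun k => by
    have := posSemidef_conjTranspose_mul_self (Q k)
    rwa [hQH, hQQ] at this
  have hc : (0 : ℂ) ≤ (Fintype.card ι : ℂ)⁻¹ := by
    rw [← Complex.ofReal_natCast, ← Complex.ofReal_inv]
    exact Complex.zero_le_real.mpr (by positivity)
  -- `Q k` projects onto the complement of Bob's possible states, so sharing it equally among the
  -- answers completes his POVM harmlessly.
  refine ⟨⟨d, fun k => (F * E k * Fᴴ)ᵀ, fun k i => P k i + (Fintype.card ι : ℂ)⁻¹ • Q k,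
    fun k => ?_, ?_, fun k i => ?_, fun k => ?_⟩, ?_⟩
  · have := (posSemidef_self_mul_conjTranspose (F * E k)).transpose
    rwa [conjTranspose_mul, hEH, ← Matrix.mul_assoc, Matrix.mul_assoc F, hEE] at this
  · rw [← transpose_sum, ← Finset.sum_mul, ← Finset.mul_sum]
    have : ∑ k, E k = 1 := by
      ext a b
      simp [E, Matrix.sum_apply, single_apply, one_apply, ite_and]
    rw [this, Matrix.mul_one, hF', transpose_one]
  · exact (posSemidef_self_mul_conjTranspose _).add ((hQ k).smul hc)
  · rw [Finset.sum_add_distrib, Finset.sum_const, Finset.card_univ, ← Nat.cast_smul_eq_nsmul ℂ,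
      smul_smul, mul_inv_cancel₀ (by simp), one_smul]
    simp [Q]
  · intro k i j hij
    change inner ℂ (entangledState (U i)) (toEuclideanLin
      ((F * E k * Fᴴ)ᵀ ⊗ₖ (P k j + (Fintype.card ι : ℂ)⁻¹ • Q k)) (entangledState (U i))) = 0
    have e : (U i)ᴴ * (P k j + (Fintype.card ι : ℂ)⁻¹ • Q k) * U i * (F * E k * Fᴴ) =
        (U i)ᴴ * ((P k j + (Fintype.card ι : ℂ)⁻¹ • Q k) * T k i) * Fᴴ := by
      simp only [T, Matrix.mul_assoc]
    rw [inner_entangledState, transpose_transpose, e, Matrix.add_mul, hPT, if_neg (Ne.symm hij),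
      Matrix.smul_mul, hQT]
    simp

open scoped MatrixOrder Matrix.Norms.L2Operator in
/-- If `tr (Uᴴ B U A) = 0` for positive semidefinite `A` and `B`, then `B U A = 0`. -/
lemma mul_mul_eq_zero_of_trace {n : Type*} [Fintype n] [DecidableEq n] {A B U : Matrix n n ℂ}
    (hA : A.PosSemidef) (hB : B.PosSemidef) (h : trace (Uᴴ * B * U * A) = 0) : B * U * A = 0 := by
  obtain ⟨P, rfl⟩ := CStarAlgebra.nonneg_iff_eq_star_mul_self.mp hB.nonneg
  obtain ⟨Q, rfl⟩ := CStarAlgebra.nonneg_iff_eq_mul_star_self.mp hA.nonneg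
  -- The trace is now the squared Hilbert–Schmidt norm of `P * U * Q`.
  simp only [star_eq_conjTranspose] at *
  have : P * U * Q = 0 := by
    rw [← trace_conjTranspose_mul_self_eq_zero_iff, ← h, ← Matrix.mul_assoc _ Q, trace_mul_comm _ Qᴴ]
    simp only [conjTranspose_mul, Matrix.mul_assoc]
  calc Pᴴ * P * U * (Q * Qᴴ) = Pᴴ * (P * U * Q) * Qᴴ := by simp only [Matrix.mul_assoc]
    _ = 0 := by simp [this]

/-- In a one-way LOCC protocol distinguishing the states `(I ⊗ Uᵢ) Φ`, the measurement of Alice has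
effects `A` (transposed) with `A Uᵢᴴ Uⱼ A = 0` for `i ≠ j`. -/
lemma OneWayDistinguishable.exists_povm {d : ℕ} (hd : d ≠ 0) {ι : Type*} [Fintype ι]
    {U : ι → Matrix (Fin d) (Fin d) ℂ}
    (h : OneWayDistinguishable (fun i => entangledState (U i))) :
    ∃ (n : ℕ) (A : Fin n → Matrix (Fin d) (Fin d) ℂ), (∀ k, (A k).PosSemidef) ∧ ∑ k, A k = 1 ∧
      ∀ k i j, i ≠ j → A k * ((U i)ᴴ * U j) * A k = 0 := by
  classical
  obtain ⟨M, hM⟩ := h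
  refine ⟨M.n, fun k => (M.A k)ᵀ, fun k => (M.A_posSemidef k).transpose, ?_, fun k i j hij => ?_⟩
  · rw [← transpose_sum, M.A_sum, transpose_one]
  · have key : ∀ i l, i ≠ l → M.B k l * U i * (M.A k)ᵀ = 0 := by
      intro i l hil
      refine mul_mul_eq_zero_of_trace (M.A_posSemidef k).transpose (M.B_posSemidef k l) ?_
      have := hM k i l hil
      rw [OneWayMeasurement.op, inner_entangledState] at this
      exact (mul_eq_zero.mp this).resolve_left (inv_ne_zero (Nat.cast_ne_zero.mpr hd))
    have hAH : ((M.A k)ᵀ)ᴴ = (M.A k)ᵀ := (M.A_posSemidef k).transpose.isHermitian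
    -- Insert `∑ l, B k l = 1`: each `l` differs from `i` or from `j`, so `key` or its adjoint kills
    -- every term.
    have e : (M.A k)ᵀ * ((U i)ᴴ * U j) * (M.A k)ᵀ =
        ∑ l, (M.A k)ᵀ * (U i)ᴴ * M.B k l * U j * (M.A k)ᵀ := by
      simp only [← Finset.sum_mul, ← Finset.mul_sum, M.B_sum, Matrix.mul_one]
      simp only [Matrix.mul_assoc]
    rw [e]
    refine Finset.sum_eq_zero fun l _ => ?_
    by_cases hjl : j = l
    · have := congrArg conjTranspose (key i l (hjl ▸ hij))
      rw [conjTranspose_mul, conjTranspose_mul, hAH, (M.B_posSemidef k l).isHermitian.eq,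
        conjTranspose_zero, ← Matrix.mul_assoc] at this
      rw [this, Matrix.zero_mul, Matrix.zero_mul]
    · rw [Matrix.mul_assoc _ (M.B k l), Matrix.mul_assoc _ (M.B k l * U j), key j l hjl,
        Matrix.mul_zero]

/-! ### The four unitaries -/

/-- The identity and the three Pauli matrices. -/
def pauli : Fin 4 → Matrix (Fin 2) (Fin 2) ℂ :=
  ![1, !![0, 1; 1, 0], !![0, -Complex.I; Complex.I, 0], !![1, 0; 0, -1]]

/-- The diagonal of the identity for `i = 0` and of `diag(-1, 1, …, 1)` otherwise. -/
noncomputable def signDiag {m : ℕ} (i : Fin 4) (a : Fin (m + 2)) : ℂ :=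
  if i ≠ 0 ∧ a = 0 then -1 else 1

/-- The unitaries `I` and `σᵢ ⊗ diag(-1, 1, …, 1)` on `ℂ² ⊗ ℂ^(m+2)`. -/
noncomputable def twistedPauli (m : ℕ) (i : Fin 4) :
    Matrix (Fin 2 × Fin (m + 2)) (Fin 2 × Fin (m + 2)) ℂ :=
  pauli i ⊗ₖ diagonal (signDiag i)

lemma twistedPauli_conjTranspose_mul (m : ℕ) (i j : Fin 4) :
    (twistedPauli m i)ᴴ * twistedPauli m j =
      ((pauli i)ᴴ * pauli j) ⊗ₖ diagonal (fun a => signDiag i a * signDiag j a) := by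
  have hs : star (signDiag (m := m) i) = signDiag i := by
    ext a
    simp [signDiag, apply_ite (starRingEnd ℂ)]
  rw [twistedPauli, twistedPauli, conjTranspose_kronecker, ← mul_kronecker_mul,
    diagonal_conjTranspose, hs, diagonal_mul_diagonal]

lemma pauli_conjTranspose_mul_self (i : Fin 4) : (pauli i)ᴴ * pauli i = 1 := by
  ext a b
  fin_cases i <;> fin_cases a <;> fin_cases b <;> simp [pauli, mul_apply, one_apply]

lemma trace_pauli_conjTranspose_mul {i j : Fin 4} (h : i ≠ j) :
    trace ((pauli i)ᴴ * pauli j) = 0 := by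
  revert h
  fin_cases i <;> fin_cases j <;> simp [pauli, trace, mul_apply, Fin.sum_univ_two, one_apply]

lemma twistedPauli_conjTranspose_mul_self (m : ℕ) (i : Fin 4) :
    (twistedPauli m i)ᴴ * twistedPauli m i = 1 := by
  have hs : (fun a => signDiag (m := m) i a * signDiag i a) = fun _ => 1 := by
    ext a
    unfold signDiag
    split_ifs <;> simp
  rw [twistedPauli_conjTranspose_mul, pauli_conjTranspose_mul_self, hs, diagonal_one,
    one_kronecker_one]

lemma trace_twistedPauli_conjTranspose_mul (m : ℕ) {i j : Fin 4} (h : i ≠ j) :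
    trace ((twistedPauli m i)ᴴ * twistedPauli m j) = 0 := by
  rw [twistedPauli_conjTranspose_mul, trace_kronecker, trace_pauli_conjTranspose_mul h, zero_mul]

/-! ### Alice's basis for three states -/

/-- The real number `1 / √2`. -/
noncomputable def invSqrtTwo : ℂ := ((Real.sqrt 2)⁻¹ : ℝ)

lemma invSqrtTwo_mul_self : invSqrtTwo * invSqrtTwo = 2⁻¹ := by
  rw [invSqrtTwo, ← Complex.ofReal_mul, ← mul_inv, Real.mul_self_sqrt (by norm_num)]
  simp

lemma conj_invSqrtTwo : (starRingEnd ℂ) invSqrtTwo = invSqrtTwo := Complex.conj_ofReal _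

/-- The columns of `pauliBasis l` are an eigenbasis of `pauli l`. -/
noncomputable def pauliBasis : Fin 4 → Matrix (Fin 2) (Fin 2) ℂ :=
  ![1, invSqrtTwo • !![1, 1; 1, -1], invSqrtTwo • !![1, 1; Complex.I, -Complex.I], 1]

lemma pauliBasis_conjTranspose_mul_self (l : Fin 4) :
    (pauliBasis l)ᴴ * pauliBasis l = 1 := by
  have h := invSqrtTwo_mul_self
  have hI := Complex.I_mul_I
  ext a b
  fin_cases l <;> fin_cases a <;> fin_cases b <;>
    simp [pauliBasis, mul_apply, Fin.sum_univ_two, one_apply, conj_invSqrtTwo] <;>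
    first
      | linear_combination 2 * h
      | linear_combination 2 * h - invSqrtTwo * invSqrtTwo * hI
      | linear_combination invSqrtTwo * invSqrtTwo * hI

/-- For `i ≠ j` different from `l`, the diagonal entries of `σᵢᴴ σⱼ` in the eigenbasis of `σₗ`
vanish, or have sum zero while both `i` and `j` are nonzero. -/
lemma pauliBasis_diag {m : ℕ} {l i j : Fin 4} (hij : i ≠ j) (hil : i ≠ l) (hjl : j ≠ l)
    (a b : Fin (m + 2)) :
    ((pauliBasis l)ᴴ * ((pauli i)ᴴ * pauli j) * pauliBasis l) 0 0 * (signDiag i a * signDiag j a) +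
    ((pauliBasis l)ᴴ * ((pauli i)ᴴ * pauli j) * pauliBasis l) 1 1 * (signDiag i b * signDiag j b)
      = 0 := by
  have hs : ∀ i j : Fin 4, i ≠ 0 → j ≠ 0 → ∀ a : Fin (m + 2),
      signDiag i a * signDiag j a = 1 := fun i j hi hj a => by
    by_cases ha : a = 0 <;> simp [signDiag, hi, hj, ha]
  have h0 : ∀ a : Fin (m + 2), signDiag 0 a = 1 := fun a => by simp [signDiag]
  revert hij hil hjl
  fin_cases l <;> fin_cases i <;> fin_cases j <;>
    simp [pauli, pauliBasis, mul_apply, Fin.sum_univ_two, one_apply, conj_invSqrtTwo, h0, hs] <;>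
    first
      | ring1
      | linear_combination
          invSqrtTwo * invSqrtTwo * (signDiag 3 a + signDiag 3 b) * Complex.I_mul_I

/-- The permutation `(0, a) ↦ (0, a)`, `(1, a) ↦ (1, a + 1)`. -/
def shear (m : ℕ) : Fin 2 × Fin (m + 2) ≃ Fin 2 × Fin (m + 2) :=
  Equiv.prodShear (Equiv.refl _) fun p => if p = 0 then Equiv.refl _ else Equiv.addRight 1

/-- The unitary whose columns are `(u ⊗ e_a ± v ⊗ e_{a+1}) / √2`, where `u` and `v` are the columns
of `pauliBasis l`. -/
noncomputable def entangledBasis (m : ℕ) (l : Fin 4) :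
    Matrix (Fin 2 × Fin (m + 2)) (Fin 2 × Fin (m + 2)) ℂ :=
  (pauliBasis l ⊗ₖ 1).submatrix id (shear m) * (pauliBasis 1 ⊗ₖ 1)

/-- Splits the basis change into the eigenbasis of `σ_l`, the shear, and a Hadamard (`pauliBasis 1`)
on the qubit. -/
lemma entangledBasis_conj (m : ℕ) (l : Fin 4) (X : Matrix (Fin 2) (Fin 2) ℂ)
    (Y : Matrix (Fin (m + 2)) (Fin (m + 2)) ℂ) :
    (entangledBasis m l)ᴴ * (X ⊗ₖ Y) * entangledBasis m l = (pauliBasis 1 ⊗ₖ 1)ᴴ *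
      (((pauliBasis l)ᴴ * X * pauliBasis l) ⊗ₖ Y).submatrix (shear m) (shear m) *
        (pauliBasis 1 ⊗ₖ 1) := by
  have e : (((pauliBasis l)ᴴ * X * pauliBasis l) ⊗ₖ Y) =
      (pauliBasis l ⊗ₖ 1)ᴴ * (X ⊗ₖ Y) * (pauliBasis l ⊗ₖ (1 : Matrix (Fin (m + 2)) _ ℂ)) := by
    rw [conjTranspose_kronecker, ← mul_kronecker_mul, ← mul_kronecker_mul]
    simp
  rw [e, submatrix_mul _ _ _ id _ Function.bijective_id,
    submatrix_mul _ _ _ id _ Function.bijective_id, entangledBasis, conjTranspose_mul,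
    conjTranspose_submatrix]
  simp only [Matrix.mul_assoc, submatrix_id_id]

lemma entangledBasis_conjTranspose_mul_self (m : ℕ) (l : Fin 4) :
    (entangledBasis m l)ᴴ * entangledBasis m l = 1 := by
  have h := entangledBasis_conj m l 1 1
  rwa [one_kronecker_one, Matrix.mul_one, Matrix.mul_one, pauliBasis_conjTranspose_mul_self,
    one_kronecker_one, submatrix_one_equiv, Matrix.mul_one, conjTranspose_kronecker,
    ← mul_kronecker_mul, pauliBasis_conjTranspose_mul_self, conjTranspose_one, Matrix.mul_one,
    one_kronecker_one] at h

lemma kronecker_one_conj_apply {m : ℕ} (B : Matrix (Fin 2) (Fin 2) ℂ)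
    (Y : Matrix (Fin 2 × Fin m) (Fin 2 × Fin m) ℂ) (s : Fin 2) (a : Fin m) :
    ((B ⊗ₖ 1)ᴴ * Y * (B ⊗ₖ 1) : Matrix (Fin 2 × Fin m) (Fin 2 × Fin m) ℂ) (s, a) (s, a) =
      ∑ q, ∑ p, star (B p s) * Y (p, a) (q, a) * B q s := by
  simp [mul_apply, Fintype.sum_prod_type, one_apply, apply_ite (starRingEnd ℂ)]
  ring

lemma entangledBasis_diag (m : ℕ) {l i j : Fin 4} (hij : i ≠ j) (hil : i ≠ l) (hjl : j ≠ l)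
    (k : Fin 2 × Fin (m + 2)) :
    ((entangledBasis m l)ᴴ * ((twistedPauli m i)ᴴ * twistedPauli m j) * entangledBasis m l) k k
      = 0 := by
  obtain ⟨s, a⟩ := k
  rw [twistedPauli_conjTranspose_mul, entangledBasis_conj]
  have key := pauliBasis_diag hij hil hjl a (a + 1)
  set τ := (pauliBasis l)ᴴ * ((pauli i)ᴴ * pauli j) * pauliBasis l
  have h := invSqrtTwo_mul_self
  have e : ∀ s : Fin 2, star (pauliBasis 1 0 s) * pauliBasis 1 0 s = 2⁻¹ ∧
      star (pauliBasis 1 1 s) * pauliBasis 1 1 s = 2⁻¹ := by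
    intro s
    fin_cases s <;> simp [pauliBasis, conj_invSqrtTwo, h]
  -- Cross terms vanish as the second factor is diagonal; this needs its dimension to be at least 2.
  have ha : a ≠ a + 1 := by simp
  rw [kronecker_one_conj_apply]
  simp only [Fin.sum_univ_two, submatrix_apply, shear, Equiv.prodShear_apply, kroneckerMap_apply,
    diagonal_apply, Equiv.refl_apply, Equiv.coe_addRight, one_ne_zero, if_true, if_false, ha,
    ha.symm]
  linear_combination 2⁻¹ * key + τ 0 0 * (signDiag i a * signDiag j a) * (e s).1 +
    τ 1 1 * (signDiag i (a + 1) * signDiag j (a + 1)) * (e s).2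

/-! ### Obstruction for all four states -/

lemma exists_pauli_conjTranspose_mul {k : Fin 4} (hk : k ≠ 0) :
    ∃ (i j : Fin 4) (c : ℂ), i ≠ j ∧ i ≠ 0 ∧ j ≠ 0 ∧ pauli k = c • ((pauli i)ᴴ * pauli j) := by
  fin_cases k
  · exact absurd rfl hk
  · refine ⟨2, 3, -Complex.I, by decide, by decide, by decide, ?_⟩
    ext a b
    fin_cases a <;> fin_cases b <;> simp [pauli, mul_apply]
  · refine ⟨1, 3, Complex.I, by decide, by decide, by decide, ?_⟩
    ext a b
    fin_cases a <;> fin_cases b <;> simp [pauli, mul_apply]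
  · refine ⟨1, 2, -Complex.I, by decide, by decide, by decide, ?_⟩
    ext a b
    fin_cases a <;> fin_cases b <;> simp [pauli, mul_apply]

/-- A matrix compressing all `Wᵢᴴ Wⱼ`, `i ≠ j`, to zero compresses `σ_k ⊗ |0⟩⟨0|` to zero. -/
lemma mul_pauli_single_mul {m : ℕ} {A : Matrix (Fin 2 × Fin (m + 2)) (Fin 2 × Fin (m + 2)) ℂ}
    (h : ∀ i j, i ≠ j → A * ((twistedPauli m i)ᴴ * twistedPauli m j) * A = 0)
    {k : Fin 4} (hk : k ≠ 0) : A * (pauli k ⊗ₖ single 0 0 1) * A = 0 := by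
  obtain ⟨i, j, c, hij, hi, hj, hc⟩ := exists_pauli_conjTranspose_mul hk
  have h1 := h 0 k hk.symm
  have h2 := h i j hij
  rw [twistedPauli_conjTranspose_mul] at h1 h2
  -- This is `|0⟩⟨0| = (I - D) / 2`.
  have e : pauli k ⊗ₖ single (0 : Fin (m + 2)) (0 : Fin (m + 2)) (1 : ℂ) = (2⁻¹ : ℂ) •
      (c • (((pauli i)ᴴ * pauli j) ⊗ₖ diagonal (fun a => signDiag (m := m) i a * signDiag j a)) -
        ((pauli 0)ᴴ * pauli k) ⊗ₖ diagonal (fun a => signDiag (m := m) 0 a * signDiag k a)) := by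
    rw [← smul_kronecker, ← hc]
    ext ⟨p, a⟩ ⟨q, b⟩
    by_cases hab : a = b
    · subst hab
      by_cases ha : a = 0
      · simp [signDiag, pauli, hi, hj, hk, ha]
        ring
      · simp [signDiag, pauli, hi, hj, hk, ha, Ne.symm ha]
    · simp [hab, single_apply]
      rintro rfl rfl
      exact absurd rfl hab
  rw [e, Matrix.mul_smul, Matrix.smul_mul, Matrix.mul_sub, Matrix.sub_mul, Matrix.mul_smul,
    Matrix.smul_mul, h1, h2]
  simp

lemma apply_zero_eq_zero_of_twistedPauli {m : ℕ}
    {A : Matrix (Fin 2 × Fin (m + 2)) (Fin 2 × Fin (m + 2)) ℂ}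
    (h : ∀ i j, i ≠ j → A * ((twistedPauli m i)ᴴ * twistedPauli m j) * A = 0) :
    A (0, 0) (0, 0) = 0 := by
  have e : ∀ (X : Matrix (Fin 2) (Fin 2) ℂ) (x y : Fin 2 × Fin (m + 2)),
      (A * (X ⊗ₖ single 0 0 1) * A : Matrix _ _ ℂ) x y =
        ∑ q, ∑ p, A x (p, 0) * X p q * A (q, 0) y := by
    intro X x y
    simp [mul_apply, Fintype.sum_prod_type, single_apply, ite_and]
    ring
  have key : ∀ k ≠ 0, ∀ x y, ∑ q, ∑ p, A x (p, 0) * pauli k p q * A (q, 0) y = 0 :=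
    fun k hk x y => by rw [← e, mul_pauli_single_mul h hk, Matrix.zero_apply]
  simp only [Fin.sum_univ_two] at key
  have h1 : ∀ x y, A x (1, 0) * A (0, 0) y + A x (0, 0) * A (1, 0) y = 0 := fun x y => by
    simpa [pauli] using key 1 (by decide) x y
  have h2 : ∀ x y,
      A x (1, 0) * Complex.I * A (0, 0) y + -(A x (0, 0) * Complex.I * A (1, 0) y) = 0 :=
    fun x y => by simpa [pauli] using key 2 (by decide) x y
  have h3 : ∀ x y, A x (0, 0) * A (0, 0) y + -(A x (1, 0) * A (1, 0) y) = 0 := fun x y => by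
    simpa [pauli] using key 3 (by decide) x y
  -- Combining `σ₁` and `σ₂` isolates the matrix unit `|0⟩⟨1|`.
  have h01 : ∀ x y, A x (0, 0) * A (1, 0) y = 0 := fun x y => by
    linear_combination 2⁻¹ * h1 x y + 2⁻¹ * Complex.I * h2 x y +
      2⁻¹ * (A x (0, 0) * A (1, 0) y - A x (1, 0) * A (0, 0) y) * Complex.I_mul_I
  have hz : A (0, 0) (0, 0) ^ 3 = 0 := by
    linear_combination A (0, 0) (0, 0) * h3 (0, 0) (0, 0) +
      A (0, 0) (1, 0) * h01 (0, 0) (0, 0)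
  exact pow_eq_zero_iff (by norm_num) |>.mp hz

theorem mainTheorem8 :
    ∀ N : ℕ, ∃ d : ℕ, N ≤ d ∧ ∃ ψ : Fin 4 → Bipartite d,
      (∀ i, IsMaximallyEntangled (ψ i)) ∧
      Orthonormal ℂ ψ ∧
      (∀ f : Fin 3 ↪ Fin 4, OneWayDistinguishable (fun i => ψ (f i))) ∧
      ¬ OneWayDistinguishable ψ := by
  intro N
  let e : Fin (2 * (N + 2)) ≃ Fin 2 × Fin (N + 2) := finProdFinEquiv.symm
  let U : Fin 4 → Matrix (Fin (2 * (N + 2))) (Fin (2 * (N + 2))) ℂ :=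
    fun i => (twistedPauli N i).submatrix e e
  have hUU : ∀ i j, (U i)ᴴ * U j = ((twistedPauli N i)ᴴ * twistedPauli N j).submatrix e e :=
    fun i j => by simp only [U, conjTranspose_submatrix, submatrix_mul_equiv]
  have hU : ∀ i, (U i)ᴴ * U i = 1 := fun i => by
    rw [hUU, twistedPauli_conjTranspose_mul_self, submatrix_one_equiv]
  refine ⟨2 * (N + 2), by omega, fun i => entangledState (U i),
    fun i => ⟨U i, mem_unitaryGroup_iff'.mpr (hU i), rfl⟩, ?_, fun f => ?_, fun h => ?_⟩
  · rw [orthonormal_iff_ite]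
    intro i j
    rw [inner_entangledState_self]
    split_ifs with hij
    · rw [hij, hU, trace_one, Fintype.card_fin, inv_mul_cancel₀]
      exact Nat.cast_ne_zero.mpr (by omega)
    · have ht : trace ((U i)ᴴ * U j) = trace ((twistedPauli N i)ᴴ * twistedPauli N j) := by
        rw [hUU]
        exact Fintype.sum_equiv e _ _ fun _ => rfl
      rw [ht, trace_twistedPauli_conjTranspose_mul N hij, mul_zero]
  · obtain ⟨l, hl⟩ : ∃ l, ∀ i, f i ≠ l := by
      by_contra! hf
      simpa using Fintype.card_le_of_surjective f hf
    refine oneWayDistinguishable_of_unitary (fun i => U (f i)) (fun i => hU _)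
      ((entangledBasis N l).submatrix e e) ?_ fun i j hij k => ?_
    · rw [conjTranspose_submatrix, submatrix_mul_equiv, entangledBasis_conjTranspose_mul_self,
        submatrix_one_equiv]
    · rw [hUU, conjTranspose_submatrix, submatrix_mul_equiv, submatrix_mul_equiv]
      exact entangledBasis_diag N (f.injective.ne hij) (hl i) (hl j) (e k)
  · obtain ⟨n, A, -, hsum, hA⟩ := h.exists_povm (by omega)
    have key : ∀ k, A k (e.symm (0, 0)) (e.symm (0, 0)) = 0 := fun k => by
      refine apply_zero_eq_zero_of_twistedPauli (A := (A k).submatrix e.symm e.symm)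
        fun i j hij => ?_
      have hs : (twistedPauli N i)ᴴ * twistedPauli N j =
          ((U i)ᴴ * U j).submatrix e.symm e.symm := by
        rw [hUU]
        simp
      rw [hs, submatrix_mul_equiv, submatrix_mul_equiv, hA k i j hij]
      rfl
    -- Every effect is zero at this diagonal entry, where the identity is `1`.
    have := congrFun (congrFun hsum (e.symm (0, 0))) (e.symm (0, 0))
    simp [Matrix.sum_apply, key] at this
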